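/- Let $m\ge 2$ be an integer and let $\mathbb F_{3^m}\subset\mathbb F_{3^{2m}}$ be the fields with $3^m$ and $3^{2m}$ elements, and let $\mathrm{Tr}$ be the trace map from $\mathbb F_{3^{2m}}$ to $\mathbb F_3$. Consider the ternary linear code $$\mathcal C(2m,3)=\Big\{\big(\mathrm{Tr}(at^{3^m+1}+bt)+h\big)_{t\in\mathbb F_{3^{2m}}} : a\in\mathbb F_{3^m},\ b\in\mathbb F_{3^{2m}},\ h\in\mathbb F_3\Big\}$$ and let $d$ be its minimum distance. Let $\mathbb D_d(\mathcal C(2m,3))$ be the incidence structure with point set $\mathbb F_{3^{2m}}$ whose blocks are the supports of the codewords of weight $d$ in $\mathcal C(2m,3)$, and let $\mathcal C_3(\mathbb D_d(\mathcal C(2m,3)))\subseteq\mathbb F_3^{\,\mathbb F_{3^{2m}}}$ be the code spanned over $\mathbb F_3$ by the rows of its (blocks by points) incidence matrix. For a primitive element $\xi$ of $\mathbb F_{3^{2m}}$ and $n=3^{2m}-1$, let $\mathcal R_3(4,2m)^*$ be the cyclic code of length $n$ over $\mathbb F_3$ with generator polynomial $\prod(x-\xi^i)$, the product over all $1\le i\le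 n-1$ whose sum of ternary digits is less than $4m-4$; let $\mathcal R_3(4,2m)$ be its extended code, obtained by adjoining to each codeword $(c_0,\dots,c_{n-1})$ the coordinate $c_n=-\sum_{i<n}c_i$. Its coordinates are indexed by $\mathbb F_{3^{2m}}$, with $c_i$ at the point $\xi^i$ for $i<n$ and $c_n$ at the point $0$. Then $\mathcal C_3(\mathbb D_d(\mathcal C(2m,3)))$ has length $3^{2m}$ and dimension $\frac{9m^2+7m}{2}+1$, it is a subcode of $\mathcal R_3(4,2m)$ for every primitive element $\xi$, and its minimum distance is at least $3^{2m-2}$. -/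

import Mathlib

namespace DesignCode

section General

variable {F ι : Type*} [Field F] [DecidableEq F] [Fintype ι]

/-- The minimum distance of a code `C ⊆ F^ι`: the least Hamming distance between two
different codewords. -/
noncomputable def minDist (C : Submodule F (ι → F)) : ℕ :=
  sInf {d | ∃ x ∈ C, ∃ y ∈ C, x ≠ y ∧ hammingDist x y = d}

/-- The block set of the support design `𝔻_w(C)`: the supports of the codewords of
weight `w`. It is a set, so there are no repeated blocks. -/
def supportBlocks (C : Submodule F (ι → F)) (w : ℕ) : Set (Set ι) :=
  {B | ∃ c ∈ C, hammingNorm c = w ∧ B = Function.support c}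

end General

section Incidence

variable (F : Type*) {ι : Type*} [Field F]

open Classical in
/-- The incidence matrix of the block set `𝓑` on the point set `ι`, with entries in `F`:
rows are indexed by blocks, columns by points. -/
noncomputable def incidenceMatrix (𝓑 : Set (Set ι)) : Matrix 𝓑 ι F :=
  Matrix.of fun B x => if x ∈ (B : Set ι) then 1 else 0

/-- The linear code over `F` of an incidence structure: the span of the rows of its
incidence matrix. -/
noncomputable def codeOfBlocks (𝓑 : Set (Set ι)) : Submodule F (ι → F) :=
  Submodule.span F (Set.range (incidenceMatrix F 𝓑).row)

end Incidence

section Hermitian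

variable (p m : ℕ) [Fact p.Prime] (K : Type*) [Field K] [Algebra (ZMod p) K]

/-- The word `c(a,b,h) = (Tr(a t^{p^m+1} + b t) + h)_{t ∈ K}`, where `Tr` is the trace
from `K` to the prime field. -/
noncomputable def hermitianWord (a b : K) (h : ZMod p) : K → ZMod p :=
  fun t => Algebra.trace (ZMod p) K (a * t ^ (p ^ m + 1) + b * t) + h

/-- The code `𝒞(2m,p) = {c(a,b,h) : a ∈ 𝔽_{p^m}, b ∈ K, h ∈ 𝔽_p}` for a field `K` with
`p^{2m}` elements; the subfield `𝔽_{p^m}` of `K` is the set of all `a` with `a^{p^m} = a`. -/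
noncomputable def hermitianCode : Submodule (ZMod p) (K → ZMod p) where
  carrier := {c | ∃ a b : K, ∃ h : ZMod p, a ^ p ^ m = a ∧ c = hermitianWord p m K a b h}
  zero_mem' := by
    refine ⟨0, 0, 0, ?_, ?_⟩
    · exact zero_pow (pow_ne_zero _ (Fact.out : p.Prime).ne_zero)
    · funext t
      simp [hermitianWord]
  add_mem' := by
    rintro _ _ ⟨a, b, h, ha, rfl⟩ ⟨a', b', h', ha', rfl⟩
    have : CharP K p := charP_of_injective_algebraMap (algebraMap (ZMod p) K).injective p
    refine ⟨a + a', b + b', h + h', ?_, ?_⟩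
    · rw [add_pow_char_pow, ha, ha']
    · funext t
      simp only [hermitianWord, Pi.add_apply, add_mul, map_add]
      ring
  smul_mem' := by
    rintro r _ ⟨a, b, h, ha, rfl⟩
    refine ⟨r • a, r • b, r * h, ?_, ?_⟩
    · rw [smul_pow, ha, ZMod.pow_card_pow]
    · funext t
      simp only [hermitianWord, Pi.smul_apply, smul_mul_assoc, map_add, map_smul, smul_eq_mul]
      ring

/-- The code `𝒞_p(𝔻_d(𝒞(2m,p)))`: the code over `𝔽_p` of the design whose blocks are the
supports of the codewords of `𝒞(2m,p)` of minimum weight `d`. -/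
noncomputable def hermitianDesignCode [Fintype K] : Submodule (ZMod p) (K → ZMod p) :=
  codeOfBlocks (ZMod p)
    (supportBlocks (hermitianCode p m K) (minDist (hermitianCode p m K)))

end Hermitian

section ReedMuller

open Polynomial

/-- The extended code of a code of length `n`: a last coordinate is adjoined so that the
sum of all coordinates is zero. -/
def extendedCode {F : Type*} [Field F] {n : ℕ} (C : Submodule F (Fin n → F)) :
    Submodule F (Fin (n + 1) → F) where
  carrier := {c | (fun i : Fin n => c i.castSucc) ∈ C ∧ ∑ i, c i = 0}
  zero_mem' := ⟨C.zero_mem, by simp⟩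
  add_mem' := by
    rintro c d ⟨hc, hc'⟩ ⟨hd, hd'⟩
    exact ⟨C.add_mem hc hd, by simp [Finset.sum_add_distrib, hc', hd']⟩
  smul_mem' := by
    rintro r c ⟨hc, hc'⟩
    exact ⟨C.smul_mem r hc, by simp [← Finset.mul_sum, hc']⟩

variable (p s l : ℕ) [Fact p.Prime] {K : Type*} [Field K] [Algebra (ZMod p) K] (ξ : K)

/-- The generator polynomial `∏ (X - ξ^i)` of the punctured generalized Reed-Muller code of
order `l` in `s` variables over `𝔽_p`; here `1 ≤ i ≤ p^s - 2` and the sum of the base `p` digits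
of `i` is less than `(p-1)s - l`. -/
noncomputable def grmGenerator : K[X] :=
  ∏ i ∈ (Finset.Icc 1 (p ^ s - 2)).filter (fun i => (p.digits i).sum + l < (p - 1) * s),
    (X - C (ξ ^ i))

/-- The word `(c_0, …, c_{n-1})` over `𝔽_p` read as the polynomial `∑ c_i X^i` over `K`. -/
noncomputable def wordPoly {n : ℕ} (c : Fin n → ZMod p) : K[X] :=
  ∑ i : Fin n, C (algebraMap (ZMod p) K (c i)) * X ^ (i : ℕ)

/-- The punctured generalized Reed-Muller code of order `l`: the cyclic code of length
`p^s - 1` over `𝔽_p` whose codewords are the multiples of the generator polynomial. (The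
generator polynomial divides `X^{p^s-1} - 1`, so being a multiple of it modulo `X^{p^s-1} - 1`
is the same as being a multiple of it.) -/
noncomputable def puncturedGRM : Submodule (ZMod p) (Fin (p ^ s - 1) → ZMod p) where
  carrier := {c | grmGenerator p s l ξ ∣ wordPoly p c}
  zero_mem' := by simp [wordPoly]
  add_mem' := by
    intro c d hc hd
    have h : (wordPoly p (c + d) : K[X]) = wordPoly p c + wordPoly p d := by
      simp [wordPoly, add_mul, Finset.sum_add_distrib]
    simpa only [Set.mem_ofPred_eq, h] using dvd_add hc hd
  smul_mem' := by
    intro r c hc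
    have h : (wordPoly p (r • c) : K[X]) = C (algebraMap (ZMod p) K r) * wordPoly p c := by
      simp [wordPoly, Finset.mul_sum, mul_assoc]
    simpa only [Set.mem_ofPred_eq, h] using Dvd.dvd.mul_left hc _

/-- The generalized Reed-Muller code `ℛ_p(l,s)`, the extended code of the punctured one, with
its coordinates indexed by `K`: coordinate `i < p^s - 1` is the point `ξ^i` and the adjoined
coordinate is the point `0`. -/
noncomputable def grmCode : Submodule (ZMod p) (K → ZMod p) :=
  (extendedCode (puncturedGRM p s l ξ)).comap
    (LinearMap.funLeft (ZMod p) (ZMod p)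
      (Fin.snoc (α := fun _ => K) (fun i : Fin (p ^ s - 1) => ξ ^ (i : ℕ)) 0))

end ReedMuller

end DesignCode

/-!
Let `C` be the Hermitian code. A word with `a ≠ 0` is, up to a translation of the variable,
`Tr(a t^{3^m+1}) + u`; counting zeros through the fibres of the norm map shows that the words with
`a ≠ 0` and `u ≠ 0` have minimum weight. Over `𝔽_3` the indicator function of the support of `w` is
`w ^ 2`, and polarization and second differences recover every product of two words of `C` from the
squares of the words of minimum weight. So the code of the design is the Schur square `C * C`.

After extension of scalars to `K`, the code `C` is spanned by the monomials `1`, `t^{3^i}` and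
`t^{(3^m+1) 3^j}`, hence `C * C` by the products of two of them. Counting the exponents of these
products gives the dimension. The exponents have ternary digit sum at most `4`, and a power sum
`∑ t^e` over `K` vanishes when the digit sum of `e` is less than `4m`; so the moments
`∑ c(t) t^i` of a word `c` of `C * C` vanish when the digit sum of `i` is less than `4m - 4`. These
are the parity checks of the Reed-Muller code, and they hold for all `i < 3^{2m-2} - 1`, which
gives the minimum distance.
-/

namespace DesignCode

theorem exists_pow_eq_of_pow_eq_one {G : Type*} [Group G] [IsCyclic G] {a b : ℕ} (ha : a ≠ 0)
    (hG : Nat.card G = a * b) {x : G} (hx : x ^ a = 1) : ∃ y : G, y ^ b = x := by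
  obtain ⟨g, hg⟩ := IsCyclic.exists_generator (α := G)
  obtain ⟨j, rfl⟩ := Subgroup.mem_zpowers_iff.mp (hg x)
  have hdvd : (a * b : ℤ) ∣ a * j := by
    rw [← Nat.cast_mul, ← hG, ← orderOf_eq_card_of_forall_mem_zpowers hg,
      orderOf_dvd_iff_zpow_eq_one, mul_comm, zpow_mul, zpow_natCast, hx]
  obtain ⟨i, rfl⟩ := Int.dvd_of_mul_dvd_mul_left (Nat.cast_ne_zero.mpr ha) hdvd
  exact ⟨g ^ i, by rw [mul_comm, zpow_mul, zpow_natCast]⟩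

section FrobeniusFixed

theorem pow_pow_pow_pow_eq_self {p m : ℕ} {K : Type*} [Field K] [Fintype K]
    (hK : Fintype.card K = p ^ (2 * m)) (x : K) : (x ^ p ^ m) ^ p ^ m = x := by
  rw [← pow_mul, ← pow_add, ← two_mul, ← hK, FiniteField.pow_card]

variable {p m : ℕ} [Fact p.Prime] {K : Type*} [Field K] [Algebra (ZMod p) K]

theorem two_ne_zero_of_algebra (hp : p ≠ 2) : (2 : K) ≠ 0 := by
  have := charP_of_injective_algebraMap (algebraMap (ZMod p) K).injective p
  exact Ring.two_ne_zero (ringChar.eq K p ▸ hp)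

theorem trace_pow_char_pow [Finite K] (k : ℕ) (x : K) :
    Algebra.trace (ZMod p) K (x ^ p ^ k) = Algebra.trace (ZMod p) K x := by
  induction k with
  | zero => simp
  | succ k ih =>
    rw [pow_succ, pow_mul, ← ih]
    simpa [FiniteField.coe_frobeniusAlgEquivOfAlgebraic] using Algebra.trace_eq_of_algEquiv
      (FiniteField.frobeniusAlgEquivOfAlgebraic (ZMod p) K) (x ^ p ^ k)

theorem exists_trace_mul_ne_zero [Finite K] {b : K} (hb : b ≠ 0) :
    ∃ t : K, Algebra.trace (ZMod p) K (b * t) ≠ 0 := by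
  obtain ⟨x, hx⟩ := Algebra.trace_surjective (ZMod p) K 1
  exact ⟨b⁻¹ * x, by rw [mul_inv_cancel_left₀ hb, hx]; exact one_ne_zero⟩

variable (p m K) in
/-- The subfield `𝔽_{p^m}` of `K`, as a vector space over `𝔽_p`: the elements fixed by the
`m`-th power of the Frobenius endomorphism. -/
def frobeniusFixed : Submodule (ZMod p) K where
  carrier := {a | a ^ p ^ m = a}
  zero_mem' := zero_pow (pow_ne_zero _ (Fact.out : p.Prime).ne_zero)
  add_mem' := by
    intro a b ha hb
    have := charP_of_injective_algebraMap (algebraMap (ZMod p) K).injective p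
    simp only [Set.mem_ofPred_eq] at *
    rw [add_pow_char_pow, ha, hb]
  smul_mem' := by
    intro r a ha
    simp only [Set.mem_ofPred_eq] at *
    rw [smul_pow, ha, ZMod.pow_card_pow]

theorem mem_frobeniusFixed {a : K} : a ∈ frobeniusFixed p m K ↔ a ^ p ^ m = a := Iff.rfl

theorem one_mem_frobeniusFixed : (1 : K) ∈ frobeniusFixed p m K := one_pow _

theorem mul_mem_frobeniusFixed {a b : K} (ha : a ∈ frobeniusFixed p m K)
    (hb : b ∈ frobeniusFixed p m K) : a * b ∈ frobeniusFixed p m K := by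
  rw [mem_frobeniusFixed] at *
  rw [mul_pow, ha, hb]

theorem inv_mem_frobeniusFixed {a : K} (ha : a ∈ frobeniusFixed p m K) :
    a⁻¹ ∈ frobeniusFixed p m K := by
  rw [mem_frobeniusFixed] at *
  rw [inv_pow, ha]

variable [Fintype K]

theorem add_pow_mem_frobeniusFixed (hK : Fintype.card K = p ^ (2 * m)) (x : K) :
    x + x ^ p ^ m ∈ frobeniusFixed p m K := by
  have := charP_of_injective_algebraMap (algebraMap (ZMod p) K).injective p
  rw [mem_frobeniusFixed, add_pow_char_pow, pow_pow_pow_pow_eq_self hK, add_comm]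

theorem pow_succ_mem_frobeniusFixed (hK : Fintype.card K = p ^ (2 * m)) (x : K) :
    x ^ (p ^ m + 1) ∈ frobeniusFixed p m K := by
  rw [mem_frobeniusFixed, pow_succ, mul_pow, pow_pow_pow_pow_eq_self hK, mul_comm]

theorem exists_mem_frobeniusFixed_trace_mul_ne_zero (hp : p ≠ 2)
    (hK : Fintype.card K = p ^ (2 * m)) {y : K} (hy : y ∈ frobeniusFixed p m K) (hy0 : y ≠ 0) :
    ∃ a ∈ frobeniusFixed p m K, Algebra.trace (ZMod p) K (y * a) ≠ 0 := by
  obtain ⟨x, hx⟩ := Algebra.trace_surjective (ZMod p) K 1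
  refine ⟨y⁻¹ * (x + x ^ p ^ m),
    mul_mem_frobeniusFixed (inv_mem_frobeniusFixed hy) (add_pow_mem_frobeniusFixed hK x), ?_⟩
  rw [mul_inv_cancel_left₀ hy0, map_add, trace_pow_char_pow, hx, one_add_one_eq_two]
  exact two_ne_zero_of_algebra hp

theorem exists_pow_succ_eq_of_mem_frobeniusFixed (hK : Fintype.card K = p ^ (2 * m)) {y : K}
    (hy : y ∈ frobeniusFixed p m K) (hy0 : y ≠ 0) : ∃ x : K, x ≠ 0 ∧ x ^ (p ^ m + 1) = y := by
  classical
  have hq : 1 < p ^ m := by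
    by_contra! h
    have := Fintype.one_lt_card (α := K)
    rw [hK, mul_comm, pow_mul] at this
    exact this.not_ge (pow_le_one' h 2)
  have hcard : Nat.card Kˣ = (p ^ m - 1) * (p ^ m + 1) := by
    rw [Nat.card_eq_fintype_card, Fintype.card_units, hK, mul_comm 2, pow_mul,
      mul_comm (p ^ m - 1), ← Nat.sq_sub_sq, one_pow]
  have hpow : Units.mk0 y hy0 ^ (p ^ m - 1) = 1 := by
    rw [← mul_eq_right (b := Units.mk0 y hy0), ← pow_succ, Nat.sub_add_cancel hq.le]
    exact Units.ext hy
  obtain ⟨x, hx⟩ := exists_pow_eq_of_pow_eq_one (Nat.sub_ne_zero_of_lt hq) hcard hpow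
  exact ⟨x, x.ne_zero, by simpa using congrArg Units.val hx⟩

end FrobeniusFixed

section Counting

open Finset

theorem card_mul_card_fiber {V W : Type*} [AddGroup V] [AddGroup W] [Fintype V] [Fintype W]
    [DecidableEq W] {f : V →+ W} (hf : Function.Surjective f) (w : W) :
    Fintype.card W * #{x | f x = w} = Fintype.card V := by
  rw [← card_univ (α := V), eq_comm, card_eq_sum_card_fiberwise (f := f) (t := univ) (by simp),
    sum_congr rfl fun w' _ => AddMonoidHom.card_fiber_eq_of_mem_range f (hf w') (hf w),
    sum_const, smul_eq_mul, card_univ]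

theorem mul_card_fiber_of_ne_zero {p : ℕ} [Fact p.Prime] {V : Type*} [AddCommGroup V]
    [Module (ZMod p) V] [Fintype V] {φ : V →ₗ[ZMod p] ZMod p} (hφ : φ ≠ 0) (u : ZMod p) :
    p * #{x | φ x = u} = Fintype.card V := by
  have h := card_mul_card_fiber (f := φ.toAddMonoidHom) (LinearMap.surjective hφ) u
  rwa [ZMod.card] at h

theorem hammingNorm_add_card_zeros {ι α : Type*} [Fintype ι] [Zero α] [DecidableEq α]
    (w : ι → α) : hammingNorm w + #{i | w i = 0} = Fintype.card ι := by
  rw [hammingNorm, add_comm, ← card_univ]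
  exact card_filter_add_card_filter_not _

theorem hammingNorm_comp_equiv {ι κ α : Type*} [Fintype ι] [Fintype κ] [Zero α] [DecidableEq α]
    (w : κ → α) (e : ι ≃ κ) : hammingNorm (w ∘ e) = hammingNorm w :=
  card_equiv e (by simp)

variable {K : Type*} [Field K] [Fintype K] [DecidableEq K]

theorem card_pow_eq_pow {x : K} (hx : x ≠ 0) (n : ℕ) :
    #{t : K | t ^ n = x ^ n} = #{t : K | t ^ n = 1} :=
  card_equiv (Equiv.divRight₀ x hx) fun t => by simp [div_pow, div_eq_one_iff_eq, hx]

theorem card_pow_eq_one_pos (n : ℕ) : 0 < #{t : K | t ^ n = 1} :=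
  card_pos.mpr ⟨1, by simp⟩

variable {p m : ℕ} [Fact p.Prime] [Algebra (ZMod p) K] [Fintype (frobeniusFixed p m K)]

theorem card_filter_pow_succ_of_not (hK : Fintype.card K = p ^ (2 * m)) {P : K → Prop}
    [DecidablePred P] (hP : ¬P 0) :
    #{t : K | P (t ^ (p ^ m + 1))} =
      #{y : frobeniusFixed p m K | P y} * #{t : K | t ^ (p ^ m + 1) = 1} := by
  rw [← smul_eq_mul, ← sum_const, card_eq_sum_card_fiberwise
    (f := fun t => (⟨t ^ (p ^ m + 1), pow_succ_mem_frobeniusFixed hK t⟩ : frobeniusFixed p m K))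
    (t := {y : frobeniusFixed p m K | P y}) (fun t ht => by simpa using ht)]
  refine sum_congr rfl fun y hy => ?_
  have hPy : P y := (mem_filter.mp hy).2
  obtain ⟨x, hx0, hxy⟩ := exists_pow_succ_eq_of_mem_frobeniusFixed hK y.2 fun h => hP (h ▸ hPy)
  rw [← card_pow_eq_pow hx0, hxy, filter_filter]
  congr 1
  ext t
  simp only [mem_filter, mem_univ, true_and, Subtype.ext_iff]
  exact ⟨And.right, fun h => ⟨h ▸ hPy, h⟩⟩

theorem card_filter_pow_succ_of (hK : Fintype.card K = p ^ (2 * m)) {P : K → Prop}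
    [DecidablePred P] (hP : P 0) :
    #{t : K | P (t ^ (p ^ m + 1))} + #{t : K | t ^ (p ^ m + 1) = 1} =
      #{y : frobeniusFixed p m K | P y} * #{t : K | t ^ (p ^ m + 1) = 1} + 1 := by
  have hcompl := card_filter_pow_succ_of_not hK (P := fun y => P y ∧ y ≠ 0) (by simp)
  have hK' : univ.filter (fun t : K => P (t ^ (p ^ m + 1))) =
      insert 0 (univ.filter fun t => P (t ^ (p ^ m + 1)) ∧ t ^ (p ^ m + 1) ≠ 0) := by
    ext t
    rcases eq_or_ne t 0 with rfl | ht <;> simp [*]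
  have hS : univ.filter (fun y : frobeniusFixed p m K => P y) =
      insert 0 (univ.filter fun y : frobeniusFixed p m K => P y ∧ (y : K) ≠ 0) := by
    ext y
    rcases eq_or_ne y 0 with rfl | hy <;> simp [*]
  rw [hK', hS, card_insert_of_notMem (by simp), card_insert_of_notMem (by simp), hcompl]
  ring

end Counting

section Weights

open Finset

variable {p m : ℕ} [Fact p.Prime] {K : Type*} [Field K] [Fintype K] [Algebra (ZMod p) K]

theorem mul_card_trace_mul_eq [Fintype (frobeniusFixed p m K)] (hp : p ≠ 2)
    (hK : Fintype.card K = p ^ (2 * m)) {a : K} (ha : a ∈ frobeniusFixed p m K) (ha0 : a ≠ 0)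
    (u : ZMod p) :
    p * #{y : frobeniusFixed p m K | Algebra.trace (ZMod p) K (a * y) = u} =
      Fintype.card (frobeniusFixed p m K) := by
  obtain ⟨y, hy, hne⟩ := exists_mem_frobeniusFixed_trace_mul_ne_zero hp hK ha ha0
  let φ : frobeniusFixed p m K →ₗ[ZMod p] ZMod p :=
    Algebra.trace (ZMod p) K ∘ₗ LinearMap.mulLeft (ZMod p) a ∘ₗ (frobeniusFixed p m K).subtype
  have hφ : φ ≠ 0 := fun h => hne (LinearMap.congr_fun h ⟨y, hy⟩)
  exact mul_card_fiber_of_ne_zero hφ u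

theorem mul_card_zeros_hermitianWord [Fintype (frobeniusFixed p m K)] [DecidableEq K] (hp : p ≠ 2)
    (hK : Fintype.card K = p ^ (2 * m)) {a : K} (ha : a ∈ frobeniusFixed p m K) (ha0 : a ≠ 0)
    {u : ZMod p} (hu : u ≠ 0) :
    p * #{t | hermitianWord p m K a 0 u t = 0} =
      Fintype.card (frobeniusFixed p m K) * #{t : K | t ^ (p ^ m + 1) = 1} := by
  rw [← mul_card_trace_mul_eq hp hK ha ha0 (-u), mul_assoc, ← card_filter_pow_succ_of_not hK
    (P := fun y => Algebra.trace (ZMod p) K (a * y) = -u) (by simp [hu])]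
  simp only [hermitianWord, zero_mul, add_zero, eq_neg_iff_add_eq_zero]

theorem mul_card_zeros_hermitianWord_zero [Fintype (frobeniusFixed p m K)] [DecidableEq K]
    (hp : p ≠ 2) (hK : Fintype.card K = p ^ (2 * m)) {a : K} (ha : a ∈ frobeniusFixed p m K)
    (ha0 : a ≠ 0) :
    p * (#{t | hermitianWord p m K a 0 0 t = 0} + #{t : K | t ^ (p ^ m + 1) = 1}) =
      Fintype.card (frobeniusFixed p m K) * #{t : K | t ^ (p ^ m + 1) = 1} + p := by
  rw [← mul_card_trace_mul_eq hp hK ha ha0 0, mul_assoc, ← mul_add_one,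
    ← card_filter_pow_succ_of hK (P := fun y => Algebra.trace (ZMod p) K (a * y) = 0) (by simp)]
  simp only [hermitianWord, zero_mul, add_zero]

theorem mul_card_zeros_affine_le {b : K} {u : ZMod p} (h : hermitianWord p m K 0 b u ≠ 0) :
    p * #{t | hermitianWord p m K 0 b u t = 0} ≤ Fintype.card K := by
  simp only [hermitianWord, zero_mul, zero_add, ← eq_neg_iff_add_eq_zero]
  rcases eq_or_ne b 0 with rfl | hb
  · have hu : u ≠ 0 := by
      rintro rfl
      exact h (by ext; simp [hermitianWord])
    simp [zero_eq_neg, hu]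
  · obtain ⟨t, ht⟩ := exists_trace_mul_ne_zero (p := p) hb
    let φ : K →ₗ[ZMod p] ZMod p := Algebra.trace (ZMod p) K ∘ₗ LinearMap.mulLeft (ZMod p) b
    have hφ : φ ≠ 0 := fun h => ht (LinearMap.congr_fun h t)
    exact (mul_card_fiber_of_ne_zero hφ (-u)).le

theorem hammingNorm_hermitianWord (hp : p ≠ 2) (hK : Fintype.card K = p ^ (2 * m)) {a : K}
    (ha : a ∈ frobeniusFixed p m K) (ha0 : a ≠ 0) {u : ZMod p} (hu : u ≠ 0) :
    hammingNorm (hermitianWord p m K a 0 u) = hammingNorm (hermitianWord p m K 1 0 1) := by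
  classical
  have := Fintype.ofFinite (frobeniusFixed p m K)
  have hzeros := (mul_card_zeros_hermitianWord hp hK ha ha0 hu).trans
    (mul_card_zeros_hermitianWord hp hK one_mem_frobeniusFixed one_ne_zero one_ne_zero).symm
  have hau := hammingNorm_add_card_zeros (hermitianWord p m K a 0 u)
  have h1 := hammingNorm_add_card_zeros (hermitianWord p m K 1 0 1)
  rw [Nat.eq_of_mul_eq_mul_left (Fact.out : p.Prime).pos hzeros] at hau
  omega

theorem hammingNorm_le_hermitianWord_zero (hp : p ≠ 2) (hK : Fintype.card K = p ^ (2 * m)) {a : K}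
    (ha : a ∈ frobeniusFixed p m K) (ha0 : a ≠ 0) :
    hammingNorm (hermitianWord p m K 1 0 1) ≤ hammingNorm (hermitianWord p m K a 0 0) := by
  classical
  have := Fintype.ofFinite (frobeniusFixed p m K)
  have hroots := card_pow_eq_one_pos (K := K) (p ^ m + 1)
  have hone := mul_card_zeros_hermitianWord hp hK one_mem_frobeniusFixed one_ne_zero one_ne_zero
  have hzero := mul_card_zeros_hermitianWord_zero hp hK ha ha0
  have hcard0 := hammingNorm_add_card_zeros (hermitianWord p m K a 0 0)
  have hcard1 := hammingNorm_add_card_zeros (hermitianWord p m K 1 0 1)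
  rw [← hone, ← mul_add_one] at hzero
  have := Nat.eq_of_mul_eq_mul_left (Fact.out : p.Prime).pos hzero
  omega

theorem hammingNorm_le_affine (hp : p ≠ 2) (hK : Fintype.card K = p ^ (2 * m)) {b : K}
    {u : ZMod p} (h : hermitianWord p m K 0 b u ≠ 0) :
    hammingNorm (hermitianWord p m K 1 0 1) ≤ hammingNorm (hermitianWord p m K 0 b u) := by
  classical
  have := Fintype.ofFinite (frobeniusFixed p m K)
  have hroots := card_pow_eq_one_pos (K := K) (p ^ m + 1)
  have hcardK := card_filter_pow_succ_of hK (P := fun _ : K => True) trivial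
  simp only [filter_true, card_univ] at hcardK
  have hone := mul_card_zeros_hermitianWord hp hK one_mem_frobeniusFixed one_ne_zero one_ne_zero
  have hle : p * #{t | hermitianWord p m K 0 b u t = 0} ≤
      p * #{t | hermitianWord p m K 1 0 1 t = 0} := by
    have := mul_card_zeros_affine_le h
    omega
  have hcard0 := hammingNorm_add_card_zeros (hermitianWord p m K 0 b u)
  have hcard1 := hammingNorm_add_card_zeros (hermitianWord p m K 1 0 1)
  have := Nat.le_of_mul_le_mul_left hle (Fact.out : p.Prime).pos
  omega

end Weights

section MinimumWeight

theorem le_minDist {F ι : Type*} [Field F] [DecidableEq F] [Fintype ι] {C : Submodule F (ι → F)}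
    (hC : C ≠ ⊥) {k : ℕ} (hk : ∀ w ∈ C, w ≠ 0 → k ≤ hammingNorm w) : k ≤ minDist C := by
  obtain ⟨c, hc, hc0⟩ := C.ne_bot_iff.mp hC
  refine le_csInf ⟨_, c, hc, 0, C.zero_mem, hc0, rfl⟩ ?_
  rintro _ ⟨x, hx, y, hy, hxy, rfl⟩
  rw [hammingDist_comm, hammingDist_eq_hammingNorm, neg_add_eq_sub]
  exact hk _ (C.sub_mem hx hy) (sub_ne_zero.mpr hxy)

theorem minDist_eq_hammingNorm {F ι : Type*} [Field F] [DecidableEq F] [Fintype ι]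
    {C : Submodule F (ι → F)} {c : ι → F} (hc : c ∈ C) (hc0 : c ≠ 0)
    (hmin : ∀ w ∈ C, w ≠ 0 → hammingNorm c ≤ hammingNorm w) : minDist C = hammingNorm c :=
  le_antisymm (Nat.sInf_le ⟨c, hc, 0, C.zero_mem, hc0, hammingDist_zero_right c⟩)
    (le_minDist (C.ne_bot_iff.mpr ⟨c, hc, hc0⟩) hmin)

variable {p m : ℕ} [Fact p.Prime] {K : Type*} [Field K] [Algebra (ZMod p) K]

theorem hermitianWord_mem {a : K} (ha : a ∈ frobeniusFixed p m K) (b : K) (h : ZMod p) :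
    hermitianWord p m K a b h ∈ hermitianCode p m K := ⟨a, b, h, ha, rfl⟩

variable [Fintype K]

theorem hermitianWord_apply_add (hK : Fintype.card K = p ^ (2 * m)) {a : K}
    (ha : a ∈ frobeniusFixed p m K) (u : ZMod p) (c t : K) :
    hermitianWord p m K a 0 u (t + c) =
      hermitianWord p m K a (2 * a * c ^ p ^ m)
        (u + Algebra.trace (ZMod p) K (a * c ^ (p ^ m + 1))) t := by
  have := charP_of_injective_algebraMap (algebraMap (ZMod p) K).injective p
  have hconj : Algebra.trace (ZMod p) K (a * t ^ p ^ m * c) =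
      Algebra.trace (ZMod p) K (a * t * c ^ p ^ m) := by
    rw [← trace_pow_char_pow m, mul_pow, mul_pow, mem_frobeniusFixed.mp ha,
      pow_pow_pow_pow_eq_self hK]
  have hexpand : a * (t + c) ^ (p ^ m + 1) = a * t ^ (p ^ m + 1) + a * t ^ p ^ m * c +
      a * t * c ^ p ^ m + a * c ^ (p ^ m + 1) := by
    rw [pow_succ, add_pow_char_pow]
    ring
  have hdouble : 2 * a * c ^ p ^ m * t = a * t * c ^ p ^ m + a * t * c ^ p ^ m := by ring
  simp only [hermitianWord, zero_mul, add_zero, hexpand, hdouble, map_add, hconj]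
  ring

theorem exists_hermitianWord_eq_translate (hp : p ≠ 2) (hK : Fintype.card K = p ^ (2 * m)) {a : K}
    (ha : a ∈ frobeniusFixed p m K) (ha0 : a ≠ 0) (b : K) (h : ZMod p) :
    ∃ (c : K) (u : ZMod p),
      hermitianWord p m K a b h = fun t => hermitianWord p m K a 0 u (t + c) := by
  have h2a : 2 * a ≠ 0 := mul_ne_zero (two_ne_zero_of_algebra hp) ha0
  refine ⟨(b / (2 * a)) ^ p ^ m,
    h - Algebra.trace (ZMod p) K (a * ((b / (2 * a)) ^ p ^ m) ^ (p ^ m + 1)), funext fun t => ?_⟩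
  rw [hermitianWord_apply_add hK ha, pow_pow_pow_pow_eq_self hK, mul_div_cancel₀ _ h2a,
    sub_add_cancel]

theorem translate_hermitianWord_mem (hK : Fintype.card K = p ^ (2 * m)) {a : K}
    (ha : a ∈ frobeniusFixed p m K) (u : ZMod p) (c : K) :
    (fun t => hermitianWord p m K a 0 u (t + c)) ∈ hermitianCode p m K :=
  ⟨a, _, _, ha, funext (hermitianWord_apply_add hK ha u c)⟩

theorem hammingNorm_translate_hermitianWord (hp : p ≠ 2) (hK : Fintype.card K = p ^ (2 * m))
    {a : K} (ha : a ∈ frobeniusFixed p m K) (ha0 : a ≠ 0) {u : ZMod p} (hu : u ≠ 0) (c : K) :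
    hammingNorm (fun t => hermitianWord p m K a 0 u (t + c)) =
      hammingNorm (hermitianWord p m K 1 0 1) :=
  (hammingNorm_comp_equiv _ (Equiv.addRight c)).trans (hammingNorm_hermitianWord hp hK ha ha0 hu)

theorem minDist_hermitianCode (hp : p ≠ 2) (hK : Fintype.card K = p ^ (2 * m)) :
    minDist (hermitianCode p m K) = hammingNorm (hermitianWord p m K 1 0 1) := by
  refine minDist_eq_hammingNorm (hermitianWord_mem one_mem_frobeniusFixed 0 1)
    (fun h => one_ne_zero (α := ZMod p) ?_) ?_
  · simpa [hermitianWord] using congrFun h 0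
  · rintro _ ⟨a, b, h, ha, rfl⟩ hw
    rcases eq_or_ne a 0 with rfl | ha0
    · exact hammingNorm_le_affine hp hK hw
    obtain ⟨c, u, hcu⟩ := exists_hermitianWord_eq_translate hp hK ha ha0 b h
    rw [hcu]
    rcases eq_or_ne u 0 with rfl | hu
    · exact (hammingNorm_le_hermitianWord_zero hp hK ha ha0).trans_eq
        (hammingNorm_comp_equiv _ (Equiv.addRight c)).symm
    · exact (hammingNorm_translate_hermitianWord hp hK ha ha0 hu c).ge

end MinimumWeight

section SchurSquare

theorem mul_le_of_forall_mul_self_mem {F A : Type*} [Field F] [CommRing A] [Algebra F A]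
    (hF : (2 : F) ≠ 0) {C M : Submodule F A} (hC : ∀ w ∈ C, w * w ∈ M) : C * C ≤ M := by
  refine Submodule.mul_le.mpr fun v hv w hw => ?_
  have hpolar : v * w = (2 : F)⁻¹ • ((v + w) * (v + w) - v * v - w * w) := by
    rw [eq_inv_smul_iff₀ hF, two_smul]
    ring
  rw [hpolar]
  exact M.smul_mem _ (M.sub_mem (M.sub_mem (hC _ (C.add_mem hv hw)) (hC v hv)) (hC w hw))

theorem incidenceMatrix_row_support {ι : Type*} {𝓑 : Set (Set ι)} (w : ι → ZMod 3)
    (h : Function.support w ∈ 𝓑) :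
    (incidenceMatrix (ZMod 3) 𝓑).row ⟨Function.support w, h⟩ = w * w := by
  have hsq : ∀ x : ZMod 3, x ≠ 0 → 1 = x * x := by decide
  funext t
  by_cases ht : w t = 0
  · simp [incidenceMatrix, Matrix.row, ht]
  · simpa [incidenceMatrix, Matrix.row, ht] using hsq _ ht

variable {m : ℕ} {K : Type*} [Field K] [Fintype K] [Algebra (ZMod 3) K]

theorem hermitianDesignCode_le_mul_self :
    hermitianDesignCode 3 m K ≤ hermitianCode 3 m K * hermitianCode 3 m K := by
  refine Submodule.span_le.mpr ?_
  rintro _ ⟨⟨B, hB⟩, rfl⟩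
  obtain ⟨c, hc, -, rfl⟩ := id hB
  rw [incidenceMatrix_row_support]
  exact Submodule.mul_mem_mul hc hc

theorem mul_self_mem_hermitianDesignCode {w : K → ZMod 3} (hw : w ∈ hermitianCode 3 m K)
    (hmin : hammingNorm w = minDist (hermitianCode 3 m K)) :
    w * w ∈ hermitianDesignCode 3 m K := by
  have hB : Function.support w ∈ supportBlocks (hermitianCode 3 m K)
      (minDist (hermitianCode 3 m K)) := ⟨w, hw, hmin, rfl⟩
  rw [← incidenceMatrix_row_support w hB]
  exact Submodule.subset_span ⟨_, rfl⟩

variable (hK : Fintype.card K = 3 ^ (2 * m))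

include hK

theorem translate_add_mul_self_mem {a : K} (ha : a ∈ frobeniusFixed 3 m K) (ha0 : a ≠ 0) (c : K)
    {u : ZMod 3} (hu : u ≠ 0) :
    (fun t => hermitianWord 3 m K a 0 0 (t + c) + u) *
      (fun t => hermitianWord 3 m K a 0 0 (t + c) + u) ∈ hermitianDesignCode 3 m K := by
  have hword : (fun t => hermitianWord 3 m K a 0 0 (t + c) + u) =
      fun t => hermitianWord 3 m K a 0 u (t + c) := by
    simp only [hermitianWord, add_zero]
  rw [hword]
  exact mul_self_mem_hermitianDesignCode (translate_hermitianWord_mem hK ha u c)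
    ((hammingNorm_translate_hermitianWord (by decide) hK ha ha0 hu c).trans
      (minDist_hermitianCode (by decide) hK).symm)

theorem translate_mem_hermitianDesignCode {a : K} (ha : a ∈ frobeniusFixed 3 m K) (ha0 : a ≠ 0)
    (c : K) : (fun t => hermitianWord 3 m K a 0 0 (t + c)) ∈ hermitianDesignCode 3 m K := by
  convert Submodule.sub_mem _
    (translate_add_mul_self_mem hK ha ha0 c (u := 1) (by decide))
    (translate_add_mul_self_mem hK ha ha0 c (u := -1) (by decide)) using 1
  have hsq : ∀ x : ZMod 3, x = (x + 1) * (x + 1) - (x + -1) * (x + -1) := by decide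
  exact funext fun t => hsq _

theorem const_mem_hermitianDesignCode (r : ZMod 3) :
    (fun _ => r) ∈ hermitianDesignCode 3 m K := by
  have := charP_of_injective_algebraMap (algebraMap (ZMod 3) K).injective 3
  obtain ⟨a, ha, htr⟩ := exists_mem_frobeniusFixed_trace_mul_ne_zero (by decide) hK
    one_mem_frobeniusFixed one_ne_zero
  rw [one_mul] at htr
  have ha0 : a ≠ 0 := by
    rintro rfl
    exact htr (map_zero _)
  have hmem := translate_mem_hermitianDesignCode hK ha ha0
  convert Submodule.smul_mem _ (r * (2 * Algebra.trace (ZMod 3) K a)⁻¹) (Submodule.sub_mem _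
    (Submodule.add_mem _ (hmem 1) (hmem (-1))) (Submodule.add_mem _ (hmem 0) (hmem 0))) using 1
  funext t
  have hsecond : a * (t + 1) ^ (3 ^ m + 1) + a * (t + -1) ^ (3 ^ m + 1) -
      (a * t ^ (3 ^ m + 1) + a * t ^ (3 ^ m + 1)) = a + a := by
    simp only [pow_succ, ← sub_eq_add_neg, add_pow_char_pow, sub_pow_char_pow, one_pow]
    ring
  simp only [Pi.smul_apply, Pi.sub_apply, Pi.add_apply, hermitianWord, zero_mul, add_zero,
    ← map_add, ← map_sub, hsecond, smul_eq_mul]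
  rw [map_add, ← two_mul, inv_mul_cancel_right₀ (mul_ne_zero (by decide) htr)]

theorem translate_mul_self_mem {a : K} (ha : a ∈ frobeniusFixed 3 m K) (ha0 : a ≠ 0) (c : K)
    (u : ZMod 3) :
    (fun t => hermitianWord 3 m K a 0 0 (t + c) + u) *
      (fun t => hermitianWord 3 m K a 0 0 (t + c) + u) ∈ hermitianDesignCode 3 m K := by
  rcases eq_or_ne u 0 with rfl | hu
  · convert Submodule.sub_mem _ (const_mem_hermitianDesignCode hK (-1)) (Submodule.add_mem _
      (translate_add_mul_self_mem hK ha ha0 c (u := 1) (by decide))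
      (translate_add_mul_self_mem hK ha ha0 c (u := -1) (by decide))) using 1
    have hsum : ∀ x : ZMod 3, (x + 0) * (x + 0) =
        -1 - ((x + 1) * (x + 1) + (x + -1) * (x + -1)) := by decide
    exact funext fun t => hsum _
  · exact translate_add_mul_self_mem hK ha ha0 c hu

theorem hermitianWord_mul_self_mem {a : K} (ha : a ∈ frobeniusFixed 3 m K) (ha0 : a ≠ 0) (b : K)
    (h : ZMod 3) :
    hermitianWord 3 m K a b h * hermitianWord 3 m K a b h ∈ hermitianDesignCode 3 m K := by
  obtain ⟨c, u, hcu⟩ := exists_hermitianWord_eq_translate (by decide) hK ha ha0 b h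
  have hword : hermitianWord 3 m K a b h = fun t => hermitianWord 3 m K a 0 0 (t + c) + u := by
    simp only [hcu, hermitianWord, add_zero]
  rw [hword]
  exact translate_mul_self_mem hK ha ha0 c u

theorem mul_self_mem_of_mem_hermitianCode {w : K → ZMod 3} (hw : w ∈ hermitianCode 3 m K) :
    w * w ∈ hermitianDesignCode 3 m K := by
  obtain ⟨a, b, h, ha, rfl⟩ := hw
  rcases eq_or_ne a 0 with rfl | ha0
  · have hone := one_mem_frobeniusFixed (p := 3) (m := m) (K := K)
    convert Submodule.neg_mem _ (Submodule.add_mem _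
      (hermitianWord_mul_self_mem hK hone one_ne_zero 0 0) (Submodule.add_mem _
        (hermitianWord_mul_self_mem hK hone one_ne_zero b h)
        (hermitianWord_mul_self_mem hK hone one_ne_zero (-b) (-h)))) using 1
    have hparallelogram : ∀ x y : ZMod 3,
        y * y = -(x * x + ((x + y) * (x + y) + (x - y) * (x - y))) := by decide
    funext t
    have hadd : hermitianWord 3 m K 1 b h t =
        hermitianWord 3 m K 1 0 0 t + hermitianWord 3 m K 0 b h t := by
      simp [hermitianWord, add_assoc]
    have hsub : hermitianWord 3 m K 1 (-b) (-h) t =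
        hermitianWord 3 m K 1 0 0 t - hermitianWord 3 m K 0 b h t := by
      simp only [hermitianWord, neg_mul, map_add, map_neg, zero_mul, zero_add, map_zero]
      ring
    simp only [Pi.mul_apply, Pi.neg_apply, Pi.add_apply, hadd, hsub]
    exact hparallelogram _ _
  · exact hermitianWord_mul_self_mem hK ha ha0 b h

theorem hermitianDesignCode_eq_mul_self :
    hermitianDesignCode 3 m K = hermitianCode 3 m K * hermitianCode 3 m K :=
  hermitianDesignCode_le_mul_self.antisymm
    (mul_le_of_forall_mul_self_mem (by decide) fun _ hw => mul_self_mem_of_mem_hermitianCode hK hw)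

end SchurSquare

section Digits

open Multiset (card count)
open scoped Pointwise

theorem finite_setOf_card_eq {X : Type*} [Finite X] (k : ℕ) :
    {s : Multiset X | card s = k}.Finite := by
  classical
  have := Fintype.ofFinite X
  exact Set.finite_coe_iff.mp (inferInstanceAs (Finite (Sym X k)))

theorem ncard_setOf_card_eq {X : Type*} [Fintype X] (k : ℕ) :
    {s : Multiset X | card s = k}.ncard = (Fintype.card X).multichoose k := by
  classical
  rw [← Sym.card_sym_eq_multichoose, ← Nat.card_eq_fintype_card]
  rfl

theorem finite_setOf_card_lt {X : Type*} [Finite X] (k : ℕ) :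
    {s : Multiset X | card s < k}.Finite :=
  ((Set.finite_lt_nat k).biUnion fun i _ => finite_setOf_card_eq i).subset fun _ hs =>
    Set.mem_biUnion hs rfl

theorem ncard_setOf_card_lt {X : Type*} [Fintype X] (k : ℕ) :
    {s : Multiset X | card s < k}.ncard =
      ∑ i ∈ Finset.range k, (Fintype.card X).multichoose i := by
  induction k with
  | zero => simp
  | succ k ih =>
    have hsplit : {s : Multiset X | card s < k + 1} = {s | card s < k} ∪ {s | card s = k} :=
      Set.ext fun _ => Nat.lt_succ_iff_lt_or_eq
    have hdisjoint : Disjoint {s : Multiset X | card s < k} {s | card s = k} :=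
      Set.disjoint_left.mpr fun _ hs ht => (Set.mem_ofPred.mp hs).ne ht
    rw [hsplit, Set.ncard_union_eq hdisjoint (finite_setOf_card_lt k) (finite_setOf_card_eq k), ih,
      ncard_setOf_card_eq, Finset.sum_range_succ]

variable {m : ℕ}

/-- The multiset of digit positions obtained by replacing each `j` by the conjugate pair
`(0, j)`, `(1, j)`. The position `(ε, j)` stands for the place value `p ^ (j + m * ε)`, so a
conjugate pair stands for an exponent `(p ^ m + 1) * p ^ j`. -/
def conjPairs (m : ℕ) : Multiset (Fin m) →+ Multiset (Fin 2 × Fin m) :=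
  Multiset.mapAddMonoidHom (Prod.mk 0) + Multiset.mapAddMonoidHom (Prod.mk 1)

theorem conjPairs_apply (t : Multiset (Fin m)) :
    conjPairs m t = t.map (Prod.mk 0) + t.map (Prod.mk 1) := rfl

theorem card_conjPairs (t : Multiset (Fin m)) : card (conjPairs m t) = 2 * card t := by
  rw [conjPairs_apply, Multiset.card_add, Multiset.card_map, Multiset.card_map, two_mul]

theorem count_conjPairs (x : Fin 2 × Fin m) (t : Multiset (Fin m)) :
    count x (conjPairs m t) = count x.2 t := by
  obtain ⟨ε, j⟩ := x
  have hcount : ∀ δ : Fin 2, count (δ, j) (t.map (Prod.mk δ)) = count j t := fun δ =>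
    Multiset.count_map_eq_count' _ _ (Prod.mk_right_injective δ) j
  rw [conjPairs_apply, Multiset.count_add]
  fin_cases ε
  · exact (congrArg₂ _ (hcount 0) (Multiset.count_eq_zero.mpr (by simp))).trans (add_zero _)
  · exact (congrArg₂ _ (Multiset.count_eq_zero.mpr (by simp)) (hcount 1)).trans (zero_add _)

theorem conjPairs_injective : Function.Injective (conjPairs m) := fun t u h =>
  Multiset.ext.mpr fun j => by simpa only [count_conjPairs] using congrArg (count (0, j)) h

theorem singleton_add_conjPairs_singleton_injective : Function.Injective
    fun z : (Fin 2 × Fin m) × Fin m => ({z.1} + conjPairs m {z.2} : Multiset (Fin 2 × Fin m)) := by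
  rintro ⟨x, j⟩ ⟨y, k⟩ h
  simp only at h
  rcases eq_or_ne j k with rfl | hjk
  · rw [Multiset.singleton_inj.mp (add_right_cancel h)]
  · have hy : ∀ ε, (ε, j) = y := fun ε => by
      by_contra hne
      have hcount := congrArg (count (ε, j)) h
      simp only [Multiset.count_add, count_conjPairs, Multiset.count_singleton, hne, hjk,
        if_false, if_true] at hcount
      omega
    simpa using (hy 0).trans (hy 1).symm

/-- The digit multisets of the exponents of monomials that are products of `k` monomials of the
Hermitian code, each of the latter being `1`, a `p ^ i`-th power, or a `p ^ j`-th power of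
the norm. -/
def hermitianDigits (m k : ℕ) : Set (Multiset (Fin 2 × Fin m)) :=
  {d | ∃ s t, card s + card t ≤ k ∧ s + conjPairs m t = d}

theorem card_le_of_mem_hermitianDigits {k : ℕ} {d : Multiset (Fin 2 × Fin m)}
    (hd : d ∈ hermitianDigits m k) : card d ≤ 2 * k := by
  obtain ⟨s, t, hst, rfl⟩ := hd
  rw [Multiset.card_add, card_conjPairs]
  omega

theorem count_le_of_mem_hermitianDigits {k : ℕ} {d : Multiset (Fin 2 × Fin m)}
    (hd : d ∈ hermitianDigits m k) (x : Fin 2 × Fin m) : count x d ≤ k := by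
  obtain ⟨s, t, hst, rfl⟩ := hd
  rw [Multiset.count_add, count_conjPairs]
  exact (add_le_add (Multiset.count_le_card _ _) (Multiset.count_le_card _ _)).trans hst

theorem mem_hermitianDigits_one {d : Multiset (Fin 2 × Fin m)} : d ∈ hermitianDigits m 1 ↔
    d = 0 ∨ (∃ x, d = {x}) ∨ ∃ j, d = conjPairs m {j} := by
  constructor
  · rintro ⟨s, t, hst, rfl⟩
    obtain ⟨hs, ht⟩ | ⟨hs, ht⟩ | ⟨hs, ht⟩ : (card s = 0 ∧ card t = 0) ∨
        (card s = 1 ∧ card t = 0) ∨ (card s = 0 ∧ card t = 1) := by omega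
    · exact .inl (by simp [Multiset.card_eq_zero.mp hs, Multiset.card_eq_zero.mp ht])
    · obtain ⟨x, rfl⟩ := Multiset.card_eq_one.mp hs
      exact .inr (.inl ⟨x, by simp [Multiset.card_eq_zero.mp ht]⟩)
    · obtain ⟨j, rfl⟩ := Multiset.card_eq_one.mp ht
      exact .inr (.inr ⟨j, by simp [Multiset.card_eq_zero.mp hs]⟩)
  · rintro (rfl | ⟨x, rfl⟩ | ⟨j, rfl⟩)
    · exact ⟨0, 0, by simp⟩
    · exact ⟨{x}, 0, by simp⟩
    · exact ⟨0, {j}, by simp⟩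

theorem hermitianDigits_succ (k : ℕ) :
    hermitianDigits m (k + 1) = hermitianDigits m k + hermitianDigits m 1 := by
  apply Set.Subset.antisymm
  · rintro _ ⟨s, t, hst, rfl⟩
    rcases s.empty_or_exists_mem with rfl | ⟨x, hx⟩
    · rcases t.empty_or_exists_mem with rfl | ⟨j, hj⟩
      · exact ⟨0, ⟨0, 0, by simp⟩, 0, ⟨0, 0, by simp⟩, by simp⟩
      · obtain ⟨t, rfl⟩ := Multiset.exists_cons_of_mem hj
        refine ⟨_, ⟨0, t, by simpa using hst, rfl⟩, _, mem_hermitianDigits_one.mpr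
          (.inr (.inr ⟨j, rfl⟩)), ?_⟩
        simp only [zero_add]
        rw [← map_add, ← Multiset.singleton_add, add_comm]
    · obtain ⟨s, rfl⟩ := Multiset.exists_cons_of_mem hx
      refine ⟨_, ⟨s, t, by rw [Multiset.card_cons] at hst; omega, rfl⟩, _,
        mem_hermitianDigits_one.mpr (.inr (.inl ⟨x, rfl⟩)), ?_⟩
      simp only [← Multiset.singleton_add]
      abel
  · rintro _ ⟨_, ⟨s, t, hst, rfl⟩, _, ⟨s', t', hst', rfl⟩, rfl⟩
    refine ⟨s + s', t + t', by simp only [Multiset.card_add]; omega, ?_⟩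
    rw [map_add]
    exact add_add_add_comm _ _ _ _

theorem hermitianDigits_two : hermitianDigits m 2 =
    {d | card d < 3} ∪
      Set.range (fun z : (Fin 2 × Fin m) × Fin m => {z.1} + conjPairs m {z.2}) ∪
      conjPairs m '' {t | card t = 2} := by
  apply Set.Subset.antisymm
  · rintro _ ⟨s, t, hst, rfl⟩
    obtain hlt | ⟨hs, ht⟩ | ⟨hs, ht⟩ : card s + 2 * card t < 3 ∨
        (card s = 1 ∧ card t = 1) ∨ (card s = 0 ∧ card t = 2) := by omega
    · exact .inl (.inl (by rwa [Set.mem_ofPred_eq, Multiset.card_add, card_conjPairs]))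
    · obtain ⟨x, rfl⟩ := Multiset.card_eq_one.mp hs
      obtain ⟨j, rfl⟩ := Multiset.card_eq_one.mp ht
      exact .inl (.inr ⟨(x, j), rfl⟩)
    · exact .inr ⟨t, ht, by rw [Multiset.card_eq_zero.mp hs, zero_add]⟩
  · rintro d ((hd | ⟨⟨x, j⟩, rfl⟩) | ⟨t, ht, rfl⟩)
    · exact ⟨d, 0, Nat.lt_succ_iff.mp hd, by simp⟩
    · exact ⟨{x}, {j}, le_rfl, rfl⟩
    · exact ⟨0, t, (zero_add _).trans_le ht.le, zero_add _⟩

theorem ncard_hermitianDigits_two : (hermitianDigits m 2).ncard =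
    1 + 2 * m + (2 * m + 1).choose 2 + 2 * m ^ 2 + (m + 1).choose 2 := by
  have hpair : ∀ d ∈ Set.range fun z : (Fin 2 × Fin m) × Fin m => {z.1} + conjPairs m {z.2},
      card d = 3 := by
    rintro _ ⟨z, rfl⟩
    simp [card_conjPairs]
  have hconj : ∀ d ∈ conjPairs m '' {t | card t = 2}, card d = 4 := by
    rintro _ ⟨t, ht, rfl⟩
    rw [card_conjPairs, ht]
  have hdisjoint₃ := Set.disjoint_left.mpr fun (d : Multiset (Fin 2 × Fin m))
    (hd : d ∈ {d | card d < 3}) hd' => (Set.mem_ofPred.mp hd).ne (hpair d hd')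
  have hdisjoint₄ := Set.disjoint_left.mpr fun (d : Multiset (Fin 2 × Fin m))
    (hd : d ∈ {d | card d < 3} ∪ Set.range _) hd' => (show card d < 4 from
      hd.elim (fun h => h.trans (by decide)) fun h => (hpair d h).trans_lt (by decide)).ne
        (hconj d hd')
  rw [hermitianDigits_two, Set.ncard_union_eq hdisjoint₄
      ((finite_setOf_card_lt 3).union (Set.finite_range _)) ((finite_setOf_card_eq 2).image _),
    Set.ncard_union_eq hdisjoint₃ (finite_setOf_card_lt 3) (Set.finite_range _),
    Set.ncard_image_of_injective _ conjPairs_injective,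
    Set.ncard_range_of_injective singleton_add_conjPairs_singleton_injective,
    ncard_setOf_card_lt, ncard_setOf_card_eq]
  simp only [Finset.sum_range_succ, Finset.sum_range_zero, Nat.multichoose_zero_right,
    Nat.multichoose_one_right, Nat.multichoose_eq _ 2, Nat.card_eq_fintype_card,
    Fintype.card_prod, Fintype.card_fin, Nat.add_succ_sub_one]
  ring

end Digits

section DigitSum

theorem digits_sum_add_le (p : ℕ) [Fact p.Prime] (a b : ℕ) :
    (p.digits (a + b)).sum ≤ (p.digits a).sum + (p.digits b).sum := by
  have hval : padicValNat p a.factorial + padicValNat p b.factorial ≤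
      padicValNat p (a + b).factorial := by
    rw [← padicValNat.mul a.factorial_ne_zero b.factorial_ne_zero]
    exact (padicValNat_dvd_iff_le (Nat.factorial_ne_zero _)).mp
      (pow_padicValNat_dvd.trans (Nat.factorial_mul_factorial_dvd_factorial_add a b))
  -- Legendre's formula: `(p - 1) v_p(n!)` is `n` minus the digit sum of `n`.
  have hlegendre := Nat.mul_le_mul_left (p - 1) hval
  simp only [mul_add, sub_one_mul_padicValNat_factorial] at hlegendre
  have := Nat.digit_sum_le p a
  have := Nat.digit_sum_le p b
  have := Nat.digit_sum_le p (a + b)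
  omega

theorem digits_sum_multiset_sum_le (p : ℕ) [Fact p.Prime] (s : Multiset ℕ) :
    (p.digits s.sum).sum ≤ (s.map fun n => (p.digits n).sum).sum :=
  s.le_sum_of_subadditive (fun n => (p.digits n).sum) (by simp) (digits_sum_add_le p)

variable {b : ℕ}

theorem digits_sum_eq_mod_add (hb : 1 < b) (n : ℕ) :
    (b.digits n).sum = n % b + (b.digits (n / b)).sum := by
  rcases n.eq_zero_or_pos with rfl | hn
  · simp
  · rw [Nat.digits_def' hb hn, List.sum_cons]

theorem digits_sum_pow (hb : 1 < b) (i : ℕ) : (b.digits (b ^ i)).sum = 1 := by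
  simpa [Nat.digits_of_lt b 1 one_ne_zero hb] using
    congrArg List.sum (Nat.digits_base_pow_mul hb one_pos (k := i))

theorem digits_sum_eq_div_pow_add_mod_pow (hb : 1 < b) (s n : ℕ) :
    (b.digits n).sum = (b.digits (n / b ^ s)).sum + (b.digits (n % b ^ s)).sum := by
  induction s generalizing n with
  | zero => simp [Nat.mod_one]
  | succ s ih =>
    have hmod : n % b ^ (s + 1) % b = n % b := Nat.mod_mod_of_dvd n (dvd_pow_self b (by omega))
    have hdiv : n % b ^ (s + 1) / b = n / b % b ^ s := by
      rw [pow_succ', Nat.mod_mul_right_div_self]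
    rw [digits_sum_eq_mod_add hb n, digits_sum_eq_mod_add hb (n % b ^ (s + 1)), hmod, hdiv,
      pow_succ', ← Nat.div_div_eq_div_mul, ih (n / b), add_left_comm]

theorem pow_succ_sub_one_eq (hb : 1 < b) (s : ℕ) :
    b ^ (s + 1) - 1 = b * (b ^ s - 1) + (b - 1) := by
  have hpos : 0 < b ^ s := Nat.pow_pos (by omega)
  have := Nat.le_mul_of_pos_right b hpos
  rw [pow_succ', Nat.mul_sub_one]
  omega

theorem digits_sum_pow_sub_one (hb : 1 < b) (s : ℕ) :
    (b.digits (b ^ s - 1)).sum = (b - 1) * s := by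
  induction s with
  | zero => simp
  | succ s ih =>
    rw [pow_succ_sub_one_eq hb, digits_sum_eq_mod_add hb, Nat.mul_add_mod,
      Nat.mod_eq_of_lt (by omega), Nat.mul_add_div (by omega), Nat.div_eq_of_lt (by omega),
      add_zero, ih, mul_add_one, add_comm]

theorem digits_sum_lt_of_lt_pow_sub_one (hb : 1 < b) {s n : ℕ} (hn : n < b ^ s - 1) :
    (b.digits n).sum < (b - 1) * s := by
  induction s generalizing n with
  | zero => simp at hn
  | succ s ih =>
    rw [pow_succ_sub_one_eq hb] at hn
    rw [digits_sum_eq_mod_add hb, mul_add_one]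
    have hmod := Nat.mod_lt n (by omega : 0 < b)
    rcases lt_or_ge (n / b) (b ^ s - 1) with hlt | hge
    · have := ih hlt
      omega
    · have hdiv : n / b = b ^ s - 1 :=
        le_antisymm (Nat.lt_succ_iff.mp ((Nat.div_lt_iff_lt_mul (by omega)).mpr (by
          rw [Nat.succ_mul, mul_comm]; omega))) hge
      have := Nat.div_add_mod n b
      rw [hdiv] at this ⊢
      rw [digits_sum_pow_sub_one hb]
      omega

theorem div_add_mod_modEq_sub_one (n : ℕ) {b : ℕ} (hb : b ≠ 0) :
    n / b + n % b ≡ n [MOD b - 1] := by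
  conv_rhs => rw [← Nat.div_add_mod n b]
  refine Nat.ModEq.add_right _ (((Nat.modEq_iff_dvd' (Nat.le_mul_of_pos_left _ (by omega))).mpr
    ⟨n / b, ?_⟩))
  rw [Nat.sub_one_mul]

theorem le_digits_sum_of_pow_sub_one_dvd {p : ℕ} [Fact p.Prime] {s n : ℕ} (hn : n ≠ 0)
    (hdvd : p ^ s - 1 ∣ n) : (p - 1) * s ≤ (p.digits n).sum := by
  have hp : 1 < p := (Fact.out : p.Prime).one_lt
  rcases s.eq_zero_or_pos with rfl | hs
  · simp
  have hps : 1 < p ^ s := Nat.one_lt_pow hs.ne' hp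
  induction n using Nat.strong_induction_on with
  | _ n ih =>
    rcases lt_or_ge n (p ^ s) with hlt | hge
    · have := Nat.le_of_dvd (Nat.pos_of_ne_zero hn) hdvd
      rw [show n = p ^ s - 1 by omega, digits_sum_pow_sub_one hp]
    · have hquot : 0 < n / p ^ s := Nat.div_pos hge (by omega)
      have hdecomp := Nat.div_add_mod n (p ^ s)
      have hfold : n / p ^ s + n % p ^ s < n := by nlinarith
      have hdvd' := ((div_add_mod_modEq_sub_one n (by omega)).dvd_iff dvd_rfl).mpr hdvd
      calc (p - 1) * s ≤ (p.digits (n / p ^ s + n % p ^ s)).sum :=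
          ih _ hfold (Nat.add_pos_left hquot _).ne' hdvd'
        _ ≤ (p.digits (n / p ^ s)).sum + (p.digits (n % p ^ s)).sum := digits_sum_add_le p _ _
        _ = (p.digits n).sum := (digits_sum_eq_div_pow_add_mod_pow hp s n).symm

end DigitSum

section DigitValue

variable {p m : ℕ}

/-- The number with the given multiset of digit positions in base `p`, the position `(ε, j)`
having place value `p ^ (j + m * ε)`. -/
def digitValue (p m : ℕ) : Multiset (Fin 2 × Fin m) →+ ℕ :=
  Multiset.sumAddMonoidHom.comp
    (Multiset.mapAddMonoidHom fun x => p ^ (finProdFinEquiv x : ℕ))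

theorem digitValue_apply (d : Multiset (Fin 2 × Fin m)) :
    digitValue p m d = (d.map fun x => p ^ (finProdFinEquiv x : ℕ)).sum := rfl

theorem digitValue_singleton (x : Fin 2 × Fin m) :
    digitValue p m {x} = p ^ (finProdFinEquiv x : ℕ) := by
  rw [digitValue_apply, Multiset.map_singleton, Multiset.sum_singleton]

theorem digitValue_conjPairs_singleton (j : Fin m) :
    digitValue p m (conjPairs m {j}) = (p ^ m + 1) * p ^ (j : ℕ) := by
  rw [conjPairs_apply, map_add, Multiset.map_singleton, Multiset.map_singleton,
    digitValue_singleton, digitValue_singleton]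
  simp only [finProdFinEquiv_apply_val, Fin.val_zero, Fin.val_one]
  ring

theorem digitValue_eq_finFunctionFinEquiv {d : Multiset (Fin 2 × Fin m)}
    (hd : ∀ x, d.count x < p) : digitValue p m d =
      finFunctionFinEquiv fun i : Fin (2 * m) =>
        (⟨d.count (finProdFinEquiv.symm i), hd _⟩ : Fin p) := by
  rw [digitValue_apply, Finset.sum_multiset_map_count, finFunctionFinEquiv_apply]
  refine (Finset.sum_subset d.toFinset.subset_univ fun x _ hx => ?_).trans
    (Fintype.sum_equiv finProdFinEquiv _ _ fun x => by simp)
  rw [Multiset.count_eq_zero.mpr (by simpa using hx), zero_smul]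

theorem digitValue_lt {d : Multiset (Fin 2 × Fin m)} (hd : ∀ x, d.count x < p) :
    digitValue p m d < p ^ (2 * m) := by
  rw [digitValue_eq_finFunctionFinEquiv hd]
  exact Fin.is_lt _

theorem digitValue_injOn : Set.InjOn (digitValue p m) {d | ∀ x, d.count x < p} := by
  intro d hd e he h
  rw [digitValue_eq_finFunctionFinEquiv hd, digitValue_eq_finFunctionFinEquiv he] at h
  have hcount := finFunctionFinEquiv.injective (Fin.ext h)
  exact Multiset.ext.mpr fun x => by
    simpa using congrArg Fin.val (congrFun hcount (finProdFinEquiv x))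

theorem digits_sum_digitValue_le [Fact p.Prime] (d : Multiset (Fin 2 × Fin m)) :
    (p.digits (digitValue p m d)).sum ≤ d.card := by
  refine (digits_sum_multiset_sum_le p _).trans_eq ?_
  simp [digits_sum_pow (Fact.out : p.Prime).one_lt]

/-- The exponents of the monomials spanning over `K` the `k`-th power of the Hermitian code. -/
def hermitianExponents (p m k : ℕ) : Set ℕ := digitValue p m '' hermitianDigits m k

theorem mem_hermitianExponents_one {e : ℕ} : e ∈ hermitianExponents p m 1 ↔
    e = 0 ∨ (∃ i < 2 * m, e = p ^ i) ∨ ∃ j < m, e = (p ^ m + 1) * p ^ j := by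
  constructor
  · rintro ⟨d, hd, rfl⟩
    rcases mem_hermitianDigits_one.mp hd with rfl | ⟨x, rfl⟩ | ⟨j, rfl⟩
    · exact .inl (map_zero _)
    · exact .inr (.inl ⟨_, (finProdFinEquiv x).is_lt, digitValue_singleton x⟩)
    · exact .inr (.inr ⟨j, j.is_lt, digitValue_conjPairs_singleton j⟩)
  · rintro (rfl | ⟨i, hi, rfl⟩ | ⟨j, hj, rfl⟩)
    · exact ⟨0, mem_hermitianDigits_one.mpr (.inl rfl), map_zero _⟩
    · refine ⟨_, mem_hermitianDigits_one.mpr (.inr (.inl ⟨finProdFinEquiv.symm ⟨i, hi⟩, rfl⟩)), ?_⟩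
      rw [digitValue_singleton, Equiv.apply_symm_apply]
    · exact ⟨_, mem_hermitianDigits_one.mpr (.inr (.inr ⟨⟨j, hj⟩, rfl⟩)),
        digitValue_conjPairs_singleton _⟩

end DigitValue

section ScalarExtension

variable {F L X : Type*} [Field F] [Field L] [Algebra F L]

/-- The words over `F` as words over the extension field `L`. -/
def wordMap (F L X : Type*) [Field F] [Field L] [Algebra F L] : (X → F) →ₐ[F] (X → L) :=
  (Algebra.ofId F L).compLeft X

theorem wordMap_apply (f : X → F) (t : X) : wordMap F L X f t = algebraMap F L (f t) := rfl

/-- The code over `L` spanned by a code over `F`. -/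
def extendScalars (L : Type*) [Field L] [Algebra F L] (M : Submodule F (X → F)) :
    Submodule L (X → L) :=
  Submodule.span L (wordMap F L X '' M)

theorem wordMap_mem_extendScalars {M : Submodule F (X → F)} {f : X → F} (hf : f ∈ M) :
    wordMap F L X f ∈ extendScalars L M := Submodule.subset_span ⟨f, hf, rfl⟩

theorem extendScalars_span (S : Set (X → F)) :
    extendScalars L (Submodule.span F S) = Submodule.span L (wordMap F L X '' S) := by
  rw [← Submodule.span_span_of_tower F L]
  exact congrArg (fun M : Submodule F (X → L) => Submodule.span L (M : Set (X → L)))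
    (Submodule.map_span (wordMap F L X).toLinearMap S)

theorem finrank_extendScalars [Finite X] (M : Submodule F (X → F)) :
    Module.finrank L (extendScalars L M) = Module.finrank F M := by
  let v := Module.finBasis F M
  have hindep : LinearIndependent F fun i => (v i : X → F) :=
    v.linearIndependent.map' M.subtype M.ker_subtype
  have hspan : Submodule.span F (Set.range (M.subtype ∘ v)) = M := by
    rw [Set.range_comp, ← Submodule.map_span, v.span_eq, Submodule.map_subtype_top]
  conv_lhs => rw [← hspan, extendScalars_span, ← Set.range_comp]
  exact (finrank_span_eq_card (linearIndependent_algebraMap_comp_iff.mpr hindep)).trans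
    (Fintype.card_fin _)

theorem extendScalars_mul (M N : Submodule F (X → F)) :
    extendScalars L (M * N) = extendScalars L M * extendScalars L N := by
  rw [Submodule.mul_eq_span_mul_set, extendScalars_span, Set.image_mul]
  exact (Submodule.span_mul_span L _ _).symm

end ScalarExtension

section Monomials

open scoped Pointwise

/-- The monomial function `t ↦ t ^ e`. -/
def monomialFun (K : Type*) [Monoid K] (e : ℕ) : K → K := fun t => t ^ e

theorem monomialFun_add (K : Type*) [Monoid K] (e f : ℕ) :
    monomialFun K (e + f) = monomialFun K e * monomialFun K f :=
  funext fun t => pow_add t e f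

variable {K : Type*} [Field K]

theorem span_monomialFun_mul (S T : Set ℕ) :
    Submodule.span K (monomialFun K '' S) * Submodule.span K (monomialFun K '' T) =
      Submodule.span K (monomialFun K '' (S + T)) := by
  rw [Submodule.span_mul_span]
  exact congrArg _ (Set.image_image2_distrib (monomialFun_add K)).symm

theorem linearIndepOn_monomialFun [Fintype K] :
    LinearIndepOn K (monomialFun K) (Set.Iio (Fintype.card K)) := by
  rw [linearIndepOn_iff']
  intro T g hT hg e he
  let P : Polynomial K := ∑ e ∈ T, Polynomial.monomial e (g e)
  have hdeg : P.natDegree < Fintype.card K := by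
    refine (Polynomial.natDegree_sum_le_of_forall_le (n := Fintype.card K - 1) _ _
      fun e he => ?_).trans_lt (Nat.sub_lt Fintype.card_pos one_pos)
    exact (Polynomial.natDegree_monomial_le _).trans (Nat.le_sub_one_of_lt (hT he))
  have hP : P = 0 := Polynomial.eq_zero_of_natDegree_lt_card_of_eval_eq_zero P
    Function.injective_id (fun t => by
      simpa [P, Polynomial.eval_finsetSum, monomialFun] using congrFun hg t) hdeg
  simpa [P, Polynomial.finsetSum_coeff, Polynomial.coeff_monomial, he] using
    congrArg (Polynomial.coeff · e) hP

theorem finrank_span_monomialFun [Fintype K] {T : Set ℕ} (hT : ∀ e ∈ T, e < Fintype.card K) :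
    Module.finrank K (Submodule.span K (monomialFun K '' T)) = T.ncard := by
  have := ((Set.finite_Iio _).subset hT).fintype
  rw [Set.image_eq_range, ← Nat.card_coe_set_eq, Nat.card_eq_fintype_card]
  exact finrank_span_eq_card (linearIndepOn_monomialFun.mono hT)

end Monomials

section HermitianSpan

variable {p m : ℕ} [Fact p.Prime] {K : Type*} [Field K] [Algebra (ZMod p) K]

theorem exists_eq_sum_trace_smul [Finite K] {S : Submodule (ZMod p) K}
    (hS : ∀ y ∈ S, y ≠ 0 → ∃ a ∈ S, Algebra.trace (ZMod p) K (y * a) ≠ 0) :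
    ∃ (n : ℕ) (a b : Fin n → K), (∀ k, a k ∈ S) ∧
      ∀ y ∈ S, y = ∑ k, Algebra.trace (ZMod p) K (y * a k) • b k := by
  let B : LinearMap.BilinForm (ZMod p) S := (Algebra.traceForm (ZMod p) K).restrict S
  have hB : B.Nondegenerate := .ofSeparatingLeft fun y hy => by
    by_contra hne
    obtain ⟨a, ha, htrace⟩ := hS y y.2 (by simpa using hne)
    exact htrace (hy ⟨a, ha⟩)
  let v := Module.finBasis (ZMod p) S
  refine ⟨_, fun k => v k, fun k => B.dualBasis hB v k, fun k => (v k).2, fun y hy => ?_⟩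
  have hexpand := congrArg S.subtype ((B.dualBasis hB v).sum_repr ⟨y, hy⟩)
  simp only [LinearMap.BilinForm.dualBasis_repr_apply, map_sum, map_smul] at hexpand
  exact hexpand.symm

theorem pow_mem_extendScalars [Finite K] {X : Type*} {M : Submodule (ZMod p) (X → ZMod p)}
    {S : Submodule (ZMod p) K}
    (hS : ∀ y ∈ S, y ≠ 0 → ∃ a ∈ S, Algebra.trace (ZMod p) K (y * a) ≠ 0) {f : X → K}
    (hf : ∀ t, f t ∈ S) (hM : ∀ a ∈ S, (fun t => Algebra.trace (ZMod p) K (a * f t)) ∈ M)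
    (i : ℕ) : (fun t => f t ^ p ^ i) ∈ extendScalars K M := by
  have := charP_of_injective_algebraMap (algebraMap (ZMod p) K).injective p
  obtain ⟨n, a, b, ha, hab⟩ := exists_eq_sum_trace_smul hS
  have hexpand : (fun t => f t ^ p ^ i) = ∑ k, b k ^ p ^ i •
      wordMap (ZMod p) K X (fun t => Algebra.trace (ZMod p) K (a k * f t)) := by
    funext t
    conv_lhs => rw [hab (f t) (hf t), sum_pow_char_pow]
    simp only [smul_pow, ZMod.pow_card_pow, Finset.sum_apply, Pi.smul_apply, wordMap_apply,
      smul_eq_mul]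
    exact Finset.sum_congr rfl fun k _ => by rw [Algebra.smul_def, mul_comm, mul_comm (f t)]
  rw [hexpand]
  exact Submodule.sum_mem _ fun k _ =>
    Submodule.smul_mem _ _ (wordMap_mem_extendScalars (hM _ (ha k)))

variable [Fintype K]

theorem algebraMap_trace_eq_sum_range (hK : Fintype.card K = p ^ (2 * m)) (x : K) :
    algebraMap (ZMod p) K (Algebra.trace (ZMod p) K x) =
      ∑ i ∈ Finset.range (2 * m), x ^ p ^ i := by
  have hcard := Module.card_eq_pow_finrank (K := ZMod p) (V := K)
  rw [ZMod.card, hK] at hcard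
  rw [FiniteField.algebraMap_trace_eq_sum_pow, Nat.card_zmod,
    ← Nat.pow_right_injective (Fact.out : p.Prime).two_le hcard]

theorem pow_pow_succ_mul_mem_span (hK : Fintype.card K = p ^ (2 * m)) {i : ℕ} (hi : i < 2 * m) :
    monomialFun K ((p ^ m + 1) * p ^ i) ∈
      Submodule.span K (monomialFun K '' hermitianExponents p m 1) := by
  rcases lt_or_ge i m with him | him
  · exact Submodule.subset_span
      ⟨_, mem_hermitianExponents_one.mpr (.inr (.inr ⟨i, him, rfl⟩)), rfl⟩
  · -- The norm `t ^ (p ^ m + 1)` is fixed by `x ↦ x ^ p ^ m`, so `i` matters only modulo `m`.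
    obtain ⟨j, rfl⟩ := Nat.exists_eq_add_of_le him
    refine Submodule.subset_span
      ⟨_, mem_hermitianExponents_one.mpr (.inr (.inr ⟨j, by omega, rfl⟩)), funext fun t => ?_⟩
    simp only [monomialFun]
    rw [pow_add p m j, ← mul_assoc, pow_mul t _ (p ^ j), pow_mul t _ (p ^ j), pow_mul t _ (p ^ m),
      mem_frobeniusFixed.mp (pow_succ_mem_frobeniusFixed hK t)]

theorem extendScalars_hermitianCode_le (hK : Fintype.card K = p ^ (2 * m)) :
    extendScalars K (hermitianCode p m K) ≤
      Submodule.span K (monomialFun K '' hermitianExponents p m 1) := by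
  have hmem : ∀ e ∈ hermitianExponents p m 1,
      monomialFun K e ∈ Submodule.span K (monomialFun K '' hermitianExponents p m 1) :=
    fun e he => Submodule.subset_span ⟨e, he, rfl⟩
  rw [extendScalars, Submodule.span_le]
  rintro _ ⟨_, ⟨a, b, h, -, rfl⟩, rfl⟩
  have hexpand : wordMap (ZMod p) K K (hermitianWord p m K a b h) =
      ∑ i ∈ Finset.range (2 * m), a ^ p ^ i • monomialFun K ((p ^ m + 1) * p ^ i) +
      ∑ i ∈ Finset.range (2 * m), b ^ p ^ i • monomialFun K (p ^ i) +
      algebraMap (ZMod p) K h • monomialFun K 0 := by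
    funext t
    simp only [wordMap_apply, hermitianWord, map_add, algebraMap_trace_eq_sum_range hK,
      Pi.add_apply, Finset.sum_apply, Pi.smul_apply, smul_eq_mul, monomialFun, pow_zero, mul_one,
      mul_pow, pow_mul]
  rw [hexpand]
  refine add_mem (add_mem (sum_mem fun i hi => ?_) (sum_mem fun i hi => ?_)) ?_ <;>
    refine Submodule.smul_mem _ _ ?_
  · exact pow_pow_succ_mul_mem_span hK (Finset.mem_range.mp hi)
  · exact hmem _ (mem_hermitianExponents_one.mpr
      (.inr (.inl ⟨i, Finset.mem_range.mp hi, rfl⟩)))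
  · exact hmem _ (mem_hermitianExponents_one.mpr (.inl rfl))

theorem monomialFun_mem_extendScalars (hp : p ≠ 2) (hK : Fintype.card K = p ^ (2 * m)) {e : ℕ}
    (he : e ∈ hermitianExponents p m 1) :
    monomialFun K e ∈ extendScalars K (hermitianCode p m K) := by
  rcases mem_hermitianExponents_one.mp he with rfl | ⟨i, -, rfl⟩ | ⟨i, -, rfl⟩
  · convert wordMap_mem_extendScalars (L := K)
      (hermitianWord_mem (m := m) (frobeniusFixed p m K).zero_mem 0 1) using 1
    funext t
    simp [monomialFun, wordMap_apply, hermitianWord]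
  · refine pow_mem_extendScalars (S := ⊤) (f := id) (fun y _ hy => ?_) (fun _ => trivial)
      (fun a _ => ?_) i
    · obtain ⟨t, ht⟩ := exists_trace_mul_ne_zero (p := p) hy
      exact ⟨t, trivial, ht⟩
    · convert hermitianWord_mem (m := m) (frobeniusFixed p m K).zero_mem a 0 using 1
      funext t
      simp [hermitianWord]
  · unfold monomialFun
    simp only [pow_mul]
    refine pow_mem_extendScalars (S := frobeniusFixed p m K)
      (fun y => exists_mem_frobeniusFixed_trace_mul_ne_zero hp hK)
      (pow_succ_mem_frobeniusFixed hK) (fun a ha => ?_) i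
    convert hermitianWord_mem ha 0 0 using 1
    funext t
    simp [hermitianWord]

open scoped Pointwise in
theorem extendScalars_hermitianCode_mul_self (hp : p ≠ 2) (hK : Fintype.card K = p ^ (2 * m)) :
    extendScalars K (hermitianCode p m K * hermitianCode p m K) =
      Submodule.span K (monomialFun K '' hermitianExponents p m 2) := by
  have hcode : extendScalars K (hermitianCode p m K) =
      Submodule.span K (monomialFun K '' hermitianExponents p m 1) :=
    (extendScalars_hermitianCode_le hK).antisymm (Submodule.span_le.mpr
      (Set.image_subset_iff.mpr fun e he => monomialFun_mem_extendScalars hp hK he))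
  have hexp : hermitianExponents p m 2 = hermitianExponents p m 1 + hermitianExponents p m 1 := by
    rw [hermitianExponents, hermitianDigits_succ, Set.image_add]
    rfl
  rw [extendScalars_mul, hcode, span_monomialFun_mul, hexp]

theorem finrank_hermitianCode_mul_self (hp : p ≠ 2) (hK : Fintype.card K = p ^ (2 * m)) :
    Module.finrank (ZMod p) ↥(hermitianCode p m K * hermitianCode p m K) =
      1 + 2 * m + (2 * m + 1).choose 2 + 2 * m ^ 2 + (m + 1).choose 2 := by
  have hp2 : 2 < p := (Fact.out : p.Prime).two_le.lt_of_ne' hp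
  have hcount : hermitianDigits m 2 ⊆ {d | ∀ x, d.count x < p} := fun d hd x =>
    (count_le_of_mem_hermitianDigits hd x).trans_lt hp2
  rw [← finrank_extendScalars (L := K), extendScalars_hermitianCode_mul_self hp hK,
    finrank_span_monomialFun, hermitianExponents,
    (digitValue_injOn.mono hcount).ncard_image, ncard_hermitianDigits_two]
  rintro _ ⟨d, hd, rfl⟩
  exact hK ▸ digitValue_lt (hcount hd)

end HermitianSpan

section Moments

variable {p s : ℕ} [Fact p.Prime] {F K : Type*} [Field F] [Field K] [Fintype K] [Algebra F K]

theorem sum_pow_eq_zero_of_digits_sum_lt (hK : Fintype.card K = p ^ s) {j : ℕ}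
    (hj : (p.digits j).sum < (p - 1) * s) : ∑ t : K, t ^ j = 0 := by
  classical
  rcases eq_or_ne j 0 with rfl | hj0
  · simp
  · have hunits := FiniteField.sum_pow_units K j
    rw [hK, if_neg fun hdvd => hj.not_ge (le_digits_sum_of_pow_sub_one_dvd hj0 hdvd)] at hunits
    rw [Fintype.sum_eq_add_sum_subtype_ne (· ^ j) (0 : K), zero_pow hj0, zero_add]
    exact (Fintype.sum_equiv unitsEquivNeZero (fun u : Kˣ => (u : K) ^ j) _
      fun _ => rfl).symm.trans hunits

theorem sum_mul_pow_eq_zero_of_mem_span (hK : Fintype.card K = p ^ s) {l : ℕ} {T : Set ℕ}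
    (hT : ∀ e ∈ T, (p.digits e).sum ≤ l) {f : K → K}
    (hf : f ∈ Submodule.span K (monomialFun K '' T)) {i : ℕ}
    (hi : (p.digits i).sum + l < (p - 1) * s) : ∑ t, f t * t ^ i = 0 := by
  induction hf using Submodule.span_induction with
  | mem _ hmem =>
    obtain ⟨e, he, rfl⟩ := hmem
    simp only [monomialFun, ← pow_add]
    have := digits_sum_add_le p e i
    have := hT e he
    exact sum_pow_eq_zero_of_digits_sum_lt hK (by omega)
  | zero => simp
  | add f g _ _ hf hg =>
    simp only [Pi.add_apply, add_mul, Finset.sum_add_distrib, hf, hg, add_zero]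
  | smul r f _ hf =>
    simp only [Pi.smul_apply, smul_eq_mul, mul_assoc, ← Finset.mul_sum, hf, mul_zero]

open Polynomial in
theorem sum_mul_eval_eq_zero_of_moments {N : ℕ} {c : K → F}
    (hc : ∀ i < N, ∑ t, algebraMap F K (c t) * t ^ i = 0) {P : K[X]} (hP : P.natDegree < N) :
    ∑ t, algebraMap F K (c t) * P.eval t = 0 := by
  simp only [eval_eq_sum_range' hP, Finset.mul_sum]
  rw [Finset.sum_comm]
  refine Finset.sum_eq_zero fun i hi => ?_
  simp only [mul_left_comm _ (P.coeff i), ← Finset.mul_sum, hc i (Finset.mem_range.mp hi),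
    mul_zero]

open Polynomial in
theorem lt_hammingNorm_of_moments [DecidableEq F] {N : ℕ} {c : K → F} (hc : c ≠ 0)
    (hmom : ∀ i < N, ∑ t, algebraMap F K (c t) * t ^ i = 0) : N < hammingNorm c := by
  classical
  by_contra! hle
  obtain ⟨t₀, ht₀⟩ : ∃ t, c t ≠ 0 := Function.ne_iff.mp hc
  -- A polynomial that vanishes on the support of `c` except at `t₀`.
  let P : K[X] := ∏ x ∈ ({t | c t ≠ 0} : Finset K).erase t₀, (X - C x)
  have hdeg : P.natDegree < N := by
    rw [natDegree_finsetProd_X_sub_C_eq_card]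
    exact (Finset.card_erase_lt_of_mem (by simpa using ht₀)).trans_le hle
  have hsupp : ∀ t ≠ t₀, algebraMap F K (c t) * P.eval t = 0 := by
    intro t ht
    rcases eq_or_ne (c t) 0 with hct | hct
    · simp [hct]
    · rw [eval_prod, Finset.prod_eq_zero (i := t) (by simp [ht, hct]) (by simp), mul_zero]
  have hsum := sum_mul_eval_eq_zero_of_moments hmom hdeg
  rw [Fintype.sum_eq_single t₀ hsupp] at hsum
  refine mul_ne_zero (by simpa using ht₀) ?_ hsum
  simp [P, eval_prod, Finset.prod_eq_zero_iff, sub_eq_zero]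

theorem lt_minDist_of_moments [DecidableEq F] {N : ℕ} {M : Submodule F (K → F)} (hM : M ≠ ⊥)
    (hmom : ∀ c ∈ M, ∀ i < N, ∑ t, algebraMap F K (c t) * t ^ i = 0) : N < minDist M :=
  le_minDist hM fun c hc hc0 => lt_hammingNorm_of_moments hc0 (hmom c hc)

end Moments

section ReedMuller

open Polynomial

theorem snoc_pow_bijective {K : Type*} [Field K] [Fintype K] {n : ℕ}
    (hK : Fintype.card K = n + 1) {ξ : K} (hξ : IsPrimitiveRoot ξ n) :
    Function.Bijective (Fin.snoc (α := fun _ => K) (fun i : Fin n => ξ ^ (i : ℕ)) 0) := by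
  rw [Fintype.bijective_iff_injective_and_card, Fintype.card_fin, hK, Fin.snoc_injective_iff]
  refine ⟨⟨fun i j h => Fin.ext (hξ.pow_inj i.is_lt j.is_lt h), ?_⟩, rfl⟩
  rintro ⟨i, hi⟩
  exact pow_ne_zero _ (hξ.ne_zero i.pos.ne') hi

variable {p s l : ℕ} {K : Type*} [Field K]

theorem grmGenerator_dvd_of_isRoot {ξ : K} (hξ : IsPrimitiveRoot ξ (p ^ s - 1)) {P : K[X]}
    (hP : ∀ i ≠ 0, (p.digits i).sum + l < (p - 1) * s → P.IsRoot (ξ ^ i)) :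
    grmGenerator p s l ξ ∣ P := by
  refine Finset.prod_dvd_of_coprime (fun i hi j hj hij => ?_) fun i hi => ?_
  · rw [Finset.mem_coe, Finset.mem_filter, Finset.mem_Icc] at hi hj
    refine isCoprime_X_sub_C_of_isUnit_sub (sub_ne_zero.mpr fun h => hij ?_).isUnit
    exact hξ.pow_inj (by omega) (by omega) h
  · rw [Finset.mem_filter, Finset.mem_Icc] at hi
    exact dvd_iff_isRoot.mpr (hP i (by omega) hi.2)

theorem mem_grmCode_of_moments [Fact p.Prime] [Fintype K] [Algebra (ZMod p) K]
    (hK : Fintype.card K = p ^ s) {ξ : K} (hξ : IsPrimitiveRoot ξ (p ^ s - 1))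
    (hl : l < (p - 1) * s) {c : K → ZMod p}
    (hc : ∀ i, (p.digits i).sum + l < (p - 1) * s →
      ∑ t, algebraMap (ZMod p) K (c t) * t ^ i = 0) :
    c ∈ grmCode p s l ξ := by
  have hcard : Fintype.card K = (p ^ s - 1) + 1 := by
    have := Fintype.card_pos (α := K)
    omega
  have hbij := snoc_pow_bijective hcard hξ
  refine ⟨grmGenerator_dvd_of_isRoot hξ fun i hi hdigits => ?_, ?_⟩
  · have hmom := hc i hdigits
    rw [← Fintype.sum_bijective _ hbij _ _ fun _ => rfl, Fin.sum_univ_castSucc] at hmom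
    simpa [wordPoly, eval_finsetSum, hi, ← pow_mul, mul_comm i] using hmom
  · have hmom := hc 0 (by simpa using hl)
    simp only [pow_zero, mul_one, ← map_sum, map_eq_zero] at hmom
    exact (Fintype.sum_bijective _ hbij _ _ fun _ => rfl).trans hmom

end ReedMuller

section HermitianMoments

variable {p m : ℕ} [Fact p.Prime] {K : Type*} [Field K] [Fintype K] [Algebra (ZMod p) K]

theorem sum_mul_pow_eq_zero_of_mem_hermitianCode_mul_self (hp : p ≠ 2)
    (hK : Fintype.card K = p ^ (2 * m)) {c : K → ZMod p}
    (hc : c ∈ hermitianCode p m K * hermitianCode p m K) {i : ℕ}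
    (hi : (p.digits i).sum + 4 < (p - 1) * (2 * m)) :
    ∑ t, algebraMap (ZMod p) K (c t) * t ^ i = 0 := by
  have hspan := wordMap_mem_extendScalars (L := K) hc
  rw [extendScalars_hermitianCode_mul_self hp hK] at hspan
  refine sum_mul_pow_eq_zero_of_mem_span hK ?_ hspan hi
  rintro _ ⟨d, hd, rfl⟩
  exact (digits_sum_digitValue_le d).trans (card_le_of_mem_hermitianDigits hd)

theorem hermitianCode_mul_self_le_grmCode (hp : p ≠ 2) (hK : Fintype.card K = p ^ (2 * m))
    (hm : 4 < (p - 1) * (2 * m)) {ξ : K} (hξ : IsPrimitiveRoot ξ (p ^ (2 * m) - 1)) :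
    hermitianCode p m K * hermitianCode p m K ≤ grmCode p (2 * m) 4 ξ := fun _ hc =>
  mem_grmCode_of_moments hK hξ hm fun _ =>
    sum_mul_pow_eq_zero_of_mem_hermitianCode_mul_self hp hK hc

theorem pow_le_minDist_hermitianCode_mul_self (hp : p ≠ 2) (hK : Fintype.card K = p ^ (2 * m))
    {r : ℕ} (hr : (p - 1) * r + 4 ≤ (p - 1) * (2 * m)) :
    p ^ r ≤ minDist (hermitianCode p m K * hermitianCode p m K) := by
  have hne : hermitianCode p m K * hermitianCode p m K ≠ ⊥ := fun h => by
    have hrank := finrank_hermitianCode_mul_self hp hK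
    rw [h, finrank_bot] at hrank
    omega
  refine Nat.le_of_pred_lt (lt_minDist_of_moments hne fun c hc i hi => ?_)
  have := digits_sum_lt_of_lt_pow_sub_one (Fact.out : p.Prime).one_lt hi
  exact sum_mul_pow_eq_zero_of_mem_hermitianCode_mul_self hp hK hc (by omega)

end HermitianMoments

end DesignCode

theorem theorem3p16_general {K : Type*} [Field K] [Fintype K] [Algebra (ZMod 3) K] {m : ℕ}
    (hm : 2 ≤ m) (hK : Fintype.card K = 3 ^ (2 * m)) :
    (Module.finrank (ZMod 3) (DesignCode.hermitianDesignCode 3 m K) : ℚ) =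
      (9 * (m : ℚ) ^ 2 + 7 * m) / 2 + 1 ∧
    (∀ ξ : K, IsPrimitiveRoot ξ (3 ^ (2 * m) - 1) →
      DesignCode.hermitianDesignCode 3 m K ≤ DesignCode.grmCode 3 (2 * m) 4 ξ) ∧
    3 ^ (2 * m - 2) ≤ DesignCode.minDist (DesignCode.hermitianDesignCode 3 m K) := by
  have hp : 3 ≠ 2 := by decide
  rw [DesignCode.hermitianDesignCode_eq_mul_self hK]
  refine ⟨?_, fun ξ hξ => DesignCode.hermitianCode_mul_self_le_grmCode hp hK (by omega) hξ,
    DesignCode.pow_le_minDist_hermitianCode_mul_self hp hK (by omega)⟩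
  rw [DesignCode.finrank_hermitianCode_mul_self hp hK]
  push_cast [Nat.cast_choose_two]
  ring

theorem theorem3p16 (m : ℕ) (hm : 2 ≤ m) [Fintype (GaloisField 3 (2 * m))] :
    Fintype.card (GaloisField 3 (2 * m)) = 3 ^ (2 * m) ∧
    (Module.finrank (ZMod 3)
        (DesignCode.hermitianDesignCode 3 m (GaloisField 3 (2 * m))) : ℚ) =
      (9 * (m : ℚ) ^ 2 + 7 * m) / 2 + 1 ∧
    (∀ ξ : GaloisField 3 (2 * m), IsPrimitiveRoot ξ (3 ^ (2 * m) - 1) →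
      DesignCode.hermitianDesignCode 3 m (GaloisField 3 (2 * m)) ≤
        DesignCode.grmCode 3 (2 * m) 4 ξ) ∧
    3 ^ (2 * m - 2) ≤
      DesignCode.minDist (DesignCode.hermitianDesignCode 3 m (GaloisField 3 (2 * m))) := by
  have hK : Fintype.card (GaloisField 3 (2 * m)) = 3 ^ (2 * m) := by
    rw [Fintype.card_eq_nat_card, GaloisField.card 3 (2 * m) (by omega)]
  exact ⟨hK, theorem3p16_general hm hK⟩
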